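/- For a real number $a$ and an integer $k\ge 0$ write $(a)_k=a(a+1)\cdots(a+k-1)$, $(a)_0=1$. Let $$P_n^{(\alpha,\beta)}(x)=\frac{(\alpha+1)_n}{n!}\sum_{k=0}^{n}\frac{(-n)_k\,(n+\alpha+\beta+1)_k}{k!\,(\alpha+1)_k}\Big(\frac{1-x}{2}\Big)^k$$ be the Jacobi polynomials and let $$\phi_n^{(\alpha,\beta)}(\mu)=\sum_{k=0}^{\lfloor n/2\rfloor}\frac{d^{2k}}{dx^{2k}}P_n^{(\alpha,\beta)}(x)\Big|_{x=1}\,\mu^k .$$ Two real polynomials $g$ and $h$ are said to have interlacing zeros if all (complex) zeros of $g$ and of $h$ are real and simple, $g$ and $h$ have no common zero, between each two consecutive zeros of $g$ there is exactly one zero of $h$, and between each two consecutive zeros of $h$ there is exactly one zero of $g$. Let $n>3$ be an integer, and let $A>0$, $-1<\alpha<1$ and $\beta>0$. Then the polynomials in $\mu$ $$2A\,\phi_n^{(\alpha,\beta)}(\mu)+(n+\alpha+\beta)\,\mu\,\phi_{n-2}^{(\alpha+1,\beta+1)}(\mu)\quad\text{and}\quad A(n+\alpha+\beta+1)\,\phi_{n-1}^{(\alpha+1,\beta+1)}(\mu)+2\,\phi_{n-1}^{(\alpha,\beta)}(\mu)$$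 have interlacing zeros. If in addition $-1<\alpha<0$, then the polynomials $$(n+\alpha+\beta+1)\,\mu\,\phi_{n-1}^{(\alpha+1,\beta+1)}(\mu)+2A\,\phi_{n-1}^{(\alpha,\beta)}(\mu)\quad\text{and}\quad 2\,\phi_n^{(\alpha,\beta)}(\mu)+A(n+\alpha+\beta)\,\phi_{n-2}^{(\alpha+1,\beta+1)}(\mu)$$ also have interlacing zeros. -/

import Mathlib

/-- The Jacobi polynomial
`P_n^{(α,β)}(x) = (α+1)_n / n! * ∑_k (-n)_k (n+α+β+1)_k / (k! (α+1)_k) * ((1-x)/2)^k`,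
where `(a)_k` is the rising factorial. The terms with `k > n` vanish. -/
noncomputable def jacobiPoly (n : ℕ) (α β : ℝ) : Polynomial ℝ :=
  Polynomial.C ((ascPochhammer ℝ n).eval (α + 1) / (n.factorial : ℝ)) *
    ∑ k ∈ Finset.range (n + 1),
      Polynomial.C ((ascPochhammer ℝ k).eval (-(n : ℝ)) *
          (ascPochhammer ℝ k).eval ((n : ℝ) + α + β + 1) /
          ((k.factorial : ℝ) * (ascPochhammer ℝ k).eval (α + 1))) *
        (Polynomial.C (1 / 2 : ℝ) * (1 - Polynomial.X)) ^ k

/-- The polynomial `φ_n^{(α,β)}(μ) = ∑_{k=0}^{⌊n/2⌋} (d^{2k}/dx^{2k} P_n^{(α,β)})(1) * μ^k`,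
in the variable `μ = Polynomial.X`. -/
noncomputable def phiPoly (n : ℕ) (α β : ℝ) : Polynomial ℝ :=
  ∑ k ∈ Finset.range (n / 2 + 1),
    Polynomial.C ((Polynomial.derivative^[2 * k] (jacobiPoly n α β)).eval 1) * Polynomial.X ^ k

/-- All complex zeros of the real polynomial `p` are real and simple. -/
def HasSimpleRealZeros (p : Polynomial ℝ) : Prop :=
  ∀ z : ℂ, Polynomial.aeval z p = 0 →
    z.im = 0 ∧ Polynomial.aeval z (Polynomial.derivative p) ≠ 0

/-- Between each two consecutive real zeros of `g` there is exactly one zero of `h`. -/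
def OneZeroBetweenZeros (g h : Polynomial ℝ) : Prop :=
  ∀ a b : ℝ, a < b → g.IsRoot a → g.IsRoot b → (∀ x ∈ Set.Ioo a b, ¬ g.IsRoot x) →
    ∃! x : ℝ, x ∈ Set.Ioo a b ∧ h.IsRoot x

/-- The zeros of `g` and `h` interlace (strictly): all zeros of `g` and `h` are real and simple,
`g` and `h` have no common zero, and between each two consecutive zeros of either polynomial
there is exactly one zero of the other one. -/
structure ZerosInterlace (g h : Polynomial ℝ) : Prop where
  simple_left : HasSimpleRealZeros g
  simple_right : HasSimpleRealZeros h
  no_common_zero : ∀ z : ℂ, ¬ (Polynomial.aeval z g = 0 ∧ Polynomial.aeval z h = 0)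
  between_left : OneZeroBetweenZeros g h
  between_right : OneZeroBetweenZeros h g

open Polynomial

/-! By the Hermite–Biehler theorem (`zerosInterlace_of_hurwitz`) it suffices that for each pair
`g(z²) + z h(z²)` has no zero with `Re z ≥ 0`. Put `t = (1 - x)/2` and `ζ = z/2`, and let `H`, `G`
be the Jacobi polynomials with parameters `α, β` and degrees `n`, `n - 1`, written in `t`. Since
differentiation maps `P_n^{(α,β)}` to a multiple of `P_{n-1}^{(α+1,β+1)}`, the even and odd
derivatives at `x = 1` combine (`derivSum_eval_zero_eq_phiPoly`) to give `g(z²) + z h(z²) = 2 U(0)`,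
where `U + ζ U' = A H + 2ζ G` for the first pair and `U + ζ U' = 2ζ H + A G` for the second.

Suppose `U(0) = 0`, so `U = t v`. Integrate the equation against `conj v` (first pair) or `conj U'`
(second pair) with the weight `t^α (1-t)^β`. Orthogonality kills the `H` term and reduces the `G`
term to leading coefficients; those of `H` and `G` have opposite signs. Integration by parts shows
that `∫ U' conj v` has positive real part when `α < 1`, and `∫ U' conj U` when `α < 0`. These signs
are incompatible with `Re ζ ≥ 0`: see `eval_zero_ne_zero_of_shift_lower` and
`eval_zero_ne_zero_of_shift_upper`. -/

/-! ### Hurwitz polynomials and the Hermite–Biehler theorem -/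

/-- Reflecting `s` in the imaginary axis brings it closer to every point of the left half-plane. -/
theorem norm_neg_conj_sub_lt {s r : ℂ} (hs : 0 < s.re) (hr : r.re < 0) :
    ‖-(starRingEnd ℂ s) - r‖ < ‖s - r‖ := by
  rw [← sq_lt_sq₀ (norm_nonneg _) (norm_nonneg _), Complex.sq_norm, Complex.sq_norm,
    Complex.normSq_apply, Complex.normSq_apply]
  simp
  nlinarith [mul_pos hs (neg_pos.2 hr)]

theorem norm_multiset_prod_lt {s : ℂ} (hs : 0 < s.re) (m : Multiset ℂ) (hm : ∀ r ∈ m, r.re < 0)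
    (h0 : m ≠ 0) :
    ‖(m.map fun r => -(starRingEnd ℂ s) - r).prod‖ < ‖(m.map fun r => s - r).prod‖ := by
  induction m using Multiset.induction with
  | empty => exact absurd rfl h0
  | cons r m ih =>
    have hr := norm_neg_conj_sub_lt hs (hm r (Multiset.mem_cons_self r m))
    simp only [Multiset.map_cons, Multiset.prod_cons, norm_mul]
    by_cases h : m = 0
    · simpa [h] using hr
    · exact mul_lt_mul'' hr (ih (fun x hx => hm x (Multiset.mem_cons_of_mem hx)) h)
        (norm_nonneg _) (norm_nonneg _)

theorem norm_eval_neg_conj_lt {F : ℂ[X]} (hd : 0 < F.natDegree)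
    (hF : ∀ z : ℂ, F.eval z = 0 → z.re < 0) {s : ℂ} (hs : 0 < s.re) :
    ‖F.eval (-(starRingEnd ℂ s))‖ < ‖F.eval s‖ := by
  have hsp := IsAlgClosed.splits F
  have hF0 : F ≠ 0 := by rintro rfl; simp at hd
  have key : ∀ z, F.eval z = F.leadingCoeff * (F.roots.map fun r => z - r).prod :=
    fun z => hsp.eval_eq_prod_roots z
  rw [key, key, norm_mul, norm_mul]
  refine mul_lt_mul_of_pos_left (norm_multiset_prod_lt hs _ ?_ ?_) (by simpa using hF0)
  · intro r hr
    exact hF r ((mem_roots hF0).1 hr)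
  · intro h
    have := hsp.natDegree_eq_card_roots
    rw [h] at this
    simp at this
    omega

theorem re_multiset_sum_pos {z : ℂ} (hz : 0 ≤ z.re) (m : Multiset ℂ) (hm : ∀ r ∈ m, r.re < 0)
    (h0 : m ≠ 0) : 0 < ((m.map fun r => 1 / (z - r)).sum).re := by
  have h1 : ∀ r : ℂ, r.re < 0 → 0 < (1 / (z - r)).re := by
    intro r hr
    have hp : 0 < (z - r).re := by simp; linarith
    rw [one_div, Complex.inv_re]
    refine div_pos hp (Complex.normSq_pos.2 ?_)
    intro h; rw [h] at hp; simp at hp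
  induction m using Multiset.induction with
  | empty => exact absurd rfl h0
  | cons r m ih =>
    have hr := h1 r (hm r (Multiset.mem_cons_self r m))
    simp only [Multiset.map_cons, Multiset.sum_cons, Complex.add_re]
    by_cases h : m = 0
    · simpa [h] using hr
    · exact add_pos hr (ih (fun x hx => hm x (Multiset.mem_cons_of_mem hx)) h)

/-- `F'/F = ∑ 1/(z - r)` over the roots, and every term has positive real part; multiply by `|F|²`.
-/
theorem re_derivative_mul_conj_pos {F : ℂ[X]} (hd : 0 < F.natDegree)
    (hF : ∀ z : ℂ, F.eval z = 0 → z.re < 0) {z : ℂ} (hz : 0 ≤ z.re) :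
    0 < (F.derivative.eval z * starRingEnd ℂ (F.eval z)).re := by
  have hsp := IsAlgClosed.splits F
  have hF0 : F ≠ 0 := by rintro rfl; simp at hd
  have hne : F.eval z ≠ 0 := fun h => absurd (hF z h) (not_lt.2 hz)
  have h := hsp.eval_derivative_div_eval_of_ne_zero hne
  rw [div_eq_iff hne] at h
  rw [h, mul_assoc, Complex.mul_conj, Complex.re_mul_ofReal]
  refine mul_pos (re_multiset_sum_pos hz _ (fun r hr => hF r ((mem_roots hF0).1 hr)) ?_)
    (Complex.normSq_pos.2 hne)
  intro h
  have := hsp.natDegree_eq_card_roots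
  rw [h] at this
  simp at this
  omega

/-- If the weighted Wronskian of `g` and `h` does not vanish on `[a, b]`, then `g` has a zero
between two zeros of `h`. -/
theorem exists_root_of_wronskian_ne_zero {g h : ℝ[X]} {ε a b : ℝ} (hab : a < b) (hb : b < 0)
    (hE : ∀ t ∈ Set.Icc a b, ε * (g.eval t * h.eval t) +
      2 * t * (g.eval t * h.derivative.eval t - g.derivative.eval t * h.eval t) ≠ 0)
    (ha0 : h.IsRoot a) (hb0 : h.IsRoot b) : ∃ x ∈ Set.Icc a b, g.IsRoot x := by
  by_contra! hg
  have hneg : ∀ t ∈ Set.Icc a b, t < 0 := fun t ht => lt_of_le_of_lt ht.2 hb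
  -- Rolle applies to `(-t)^(ε/2) h/g`: its derivative is `(-t)^(ε/2) / (2 t g²)` times the
  -- expression in `hE`.
  have hder : ∀ t ∈ Set.Icc a b, HasDerivAt (fun t => (-t) ^ (ε / 2) * (h.eval t / g.eval t))
      (-1 * (ε / 2) * (-t) ^ (ε / 2 - 1) * (h.eval t / g.eval t) + (-t) ^ (ε / 2) *
        ((h.derivative.eval t * g.eval t - h.eval t * g.derivative.eval t) / g.eval t ^ 2)) t := by
    intro t ht
    have h1 : HasDerivAt (fun t : ℝ => -t) (-1) t := (hasDerivAt_id t).neg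
    exact (h1.rpow_const (Or.inl (by linarith [hneg t ht]))).mul
      ((h.hasDerivAt t).div (g.hasDerivAt t) (hg t ht))
  obtain ⟨c, hc, hc0⟩ := exists_hasDerivAt_eq_zero hab
    (fun t ht => (hder t ht).continuousAt.continuousWithinAt)
    (by simp [ha0.eq_zero, hb0.eq_zero]) (fun t ht => hder t (Set.Ioo_subset_Icc_self ht))
  have hcI := Set.Ioo_subset_Icc_self hc
  have hcn := hneg c hcI
  have hgc : g.eval c ≠ 0 := hg c hcI
  apply hE c hcI
  have hp : 0 < (-c) ^ (ε / 2) := Real.rpow_pos_of_pos (by linarith) _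
  rw [Real.rpow_sub_one (by linarith)] at hc0
  have hc' : c ≠ 0 := hcn.ne
  field_simp at hc0
  have h3 : ((-c) ^ (ε / 2)) * (ε * (g.eval c * h.eval c) + 2 * c * (g.eval c *
      h.derivative.eval c - g.derivative.eval c * h.eval c)) = 0 := by linear_combination hc0
  exact (mul_eq_zero.1 h3).resolve_left hp.ne'

theorem oneZeroBetweenZeros_of_wronskian_ne_zero {g h : ℝ[X]} {ε : ℝ}
    (hE : ∀ t ≤ 0, ε * (g.eval t * h.eval t) +
      2 * t * (g.eval t * h.derivative.eval t - g.derivative.eval t * h.eval t) ≠ 0)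
    (hg : ∀ x, g.IsRoot x → x < 0) : OneZeroBetweenZeros g h := by
  intro a b hab ha hb hno
  have hb0 := hg b hb
  have hnc : ∀ t ≤ 0, g.IsRoot t → ¬ h.IsRoot t := by
    intro t ht h1 h2
    apply hE t ht
    simp [h1.eq_zero, h2.eq_zero]
  -- Exchanging `g` and `h` negates the Wronskian, so `ε` becomes `-ε`. Uniqueness follows because
  -- two zeros of `h` would enclose a further zero of `g`.
  obtain ⟨x, hx, hx0⟩ := exists_root_of_wronskian_ne_zero (g := h) (h := g) (ε := -ε) hab hb0
    (fun t ht h0 => hE t (ht.2.trans hb0.le) (by linear_combination -h0)) ha hb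
  have hlt : ∀ y z, y ∈ Set.Ioo a b → z ∈ Set.Ioo a b → h.IsRoot y → h.IsRoot z → ¬ y < z := by
    intro y z hy hz hy0 hz0 hyz
    obtain ⟨w, hw, hw0⟩ := exists_root_of_wronskian_ne_zero (g := g) (h := h) (ε := ε) hyz
      (hz.2.trans hb0) (fun t ht => hE t (ht.2.trans (hz.2.trans hb0).le)) hy0 hz0
    exact hno w ⟨hy.1.trans_le hw.1, hw.2.trans_lt hz.2⟩ hw0
  have hxI : x ∈ Set.Ioo a b := by
    refine ⟨lt_of_le_of_ne hx.1 ?_, lt_of_le_of_ne hx.2 ?_⟩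
    · rintro rfl; exact hnc _ (hab.le.trans hb0.le) ha hx0
    · rintro rfl; exact hnc _ hb0.le hb hx0
  refine ⟨x, ⟨hxI, hx0⟩, ?_⟩
  rintro y ⟨hy, hy0⟩
  rcases lt_trichotomy y x with h1 | h1 | h1
  · exact absurd h1 (hlt y x hy hxI hy0 hx0)
  · exact h1
  · exact absurd h1 (hlt x y hxI hy hx0 hy0)

theorem hasSimpleRealZeros_of_real_of_simple {g : ℝ[X]}
    (hg : ∀ z : ℂ, aeval z g = 0 → ∃ t : ℝ, t ≤ 0 ∧ z = t)
    (hs : ∀ t ≤ 0, g.IsRoot t → g.derivative.eval t ≠ 0) : HasSimpleRealZeros g := by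
  intro z hz
  obtain ⟨t, ht, rfl⟩ := hg z hz
  have h1 : ∀ p : ℝ[X], aeval (t : ℂ) p = ((p.eval t : ℝ) : ℂ) := fun p => by
    simpa using aeval_algebraMap_apply ℂ t p
  rw [h1] at hz
  refine ⟨Complex.ofReal_im t, ?_⟩
  rw [h1]
  exact_mod_cast hs t ht (by exact_mod_cast hz)

/-- The Hermite-Biehler theorem: if `g(z²) + z h(z²)` has no zeros in the closed right half-plane,
then the zeros of `g` and `h` interlace. -/
theorem zerosInterlace_of_hurwitz {g h : ℝ[X]} (hh : h ≠ 0)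
    (hst : ∀ z : ℂ, 0 ≤ z.re → aeval (z ^ 2) g + z * aeval (z ^ 2) h ≠ 0) :
    ZerosInterlace g h := by
  set F : ℂ[X] := (g.map (algebraMap ℝ ℂ)).comp (X ^ 2) +
    X * (h.map (algebraMap ℝ ℂ)).comp (X ^ 2) with hFdef
  have hFe : ∀ z, F.eval z = aeval (z ^ 2) g + z * aeval (z ^ 2) h := by
    intro z
    simp [hFdef, eval_comp, aeval_def, eval_map]
  have hFr : ∀ z : ℂ, F.eval z = 0 → z.re < 0 := by
    intro z hz
    by_contra! hz'
    exact hst z hz' (by rw [← hFe, hz])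
  have hFd : 0 < F.natDegree := by
    by_contra! hd
    have hc := eq_C_of_natDegree_le_zero hd
    -- If `F` were constant, `F(s) - F(-s) = 2 s h(s²)` would vanish identically.
    have hz : ∀ s : ℂ, s ≠ 0 → aeval (s ^ 2) h = 0 := by
      intro s hs
      have h1 := hFe s
      have h2 := hFe (-s)
      rw [hc, eval_C] at h1 h2
      have h3 : s * aeval (s ^ 2) h = 0 := by
        rw [neg_sq] at h2
        linear_combination (1 / 2 : ℂ) * h2 - (1 / 2 : ℂ) * h1
      exact (mul_eq_zero.1 h3).resolve_left hs
    apply hh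
    refine eq_zero_of_infinite_isRoot h (Set.Infinite.mono ?_ (Set.Ioi_infinite (0 : ℝ)))
    intro x hx
    have hx0 : (0 : ℝ) < x := hx
    have := hz ((Real.sqrt x : ℝ) : ℂ) (by
      exact_mod_cast (Real.sqrt_pos.2 hx0).ne')
    rw [← Complex.ofReal_pow, Real.sq_sqrt hx0.le] at this
    have h1 : aeval (x : ℂ) h = ((h.eval x : ℝ) : ℂ) := by
      simpa using aeval_algebraMap_apply ℂ x h
    rw [h1] at this
    exact_mod_cast this
  have hre : ∀ (p : ℝ[X]) (t : ℝ), aeval (t : ℂ) p = ((p.eval t : ℝ) : ℂ) := fun p t => by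
    simpa using aeval_algebraMap_apply ℂ t p
  have hconj : ∀ (p : ℝ[X]) (z : ℂ), aeval (starRingEnd ℂ z) p = starRingEnd ℂ (aeval z p) :=
    fun p z => aeval_conj p z
  -- This is `Re (F' conj F)` at the point `z = i √(-t)` of the imaginary axis, where `z² = t`.
  have hE : ∀ t : ℝ, t ≤ 0 → 0 < 1 * (g.eval t * h.eval t) +
      2 * t * (g.eval t * h.derivative.eval t - g.derivative.eval t * h.eval t) := by
    intro t ht
    have hz2 : (Complex.I * (Real.sqrt (-t) : ℝ)) ^ 2 = (t : ℂ) := by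
      rw [mul_pow, Complex.I_sq, ← Complex.ofReal_pow, Real.sq_sqrt (by linarith)]
      simp
    have hpos := re_derivative_mul_conj_pos hFd hFr (z := Complex.I * (Real.sqrt (-t) : ℝ))
      (by simp)
    have hFd' : F.derivative.eval (Complex.I * (Real.sqrt (-t) : ℝ)) =
        2 * (Complex.I * (Real.sqrt (-t) : ℝ)) * ((g.derivative.eval t : ℝ) : ℂ) +
          ((h.eval t : ℝ) : ℂ) + 2 * (t : ℂ) * ((h.derivative.eval t : ℝ) : ℂ) := by
      have e : F.derivative = C 2 * X * ((g.derivative.map (algebraMap ℝ ℂ)).comp (X ^ 2)) +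
          (h.map (algebraMap ℝ ℂ)).comp (X ^ 2) +
            C 2 * X ^ 2 * ((h.derivative.map (algebraMap ℝ ℂ)).comp (X ^ 2)) := by
        rw [hFdef]
        simp only [derivative_add, derivative_mul, derivative_comp, derivative_X_pow, derivative_X,
          derivative_map]
        simp
        ring
      rw [e, ← hre, ← hre, ← hre]
      simp only [eval_add, eval_mul, eval_C, eval_X, eval_pow, eval_comp, hz2, eval_map, aeval_def]
    rw [hFd', hFe, hz2, hre, hre] at hpos
    have hs := Real.mul_self_sqrt (show 0 ≤ -t by linarith)
    simp at hpos
    convert hpos using 1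
    linear_combination (-2 * g.derivative.eval t * h.eval t) * hs
  have hroot : ∀ z : ℂ, aeval z g = 0 ∨ aeval z h = 0 → ∃ t : ℝ, t ≤ 0 ∧ z = t := by
    intro z hz
    obtain ⟨s, hs, hs2⟩ : ∃ s : ℂ, 0 ≤ s.re ∧ s ^ 2 = z := by
      obtain ⟨s, hs⟩ := IsAlgClosed.exists_pow_nat_eq z (n := 2) (by norm_num)
      rcases le_total 0 s.re with h1 | h1
      · exact ⟨s, h1, hs⟩
      · exact ⟨-s, by simpa using h1, by rw [neg_sq, hs]⟩
    rcases hs.eq_or_lt with h0 | h0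
    · refine ⟨-s.im ^ 2, by nlinarith [sq_nonneg s.im], ?_⟩
      rw [← hs2]
      apply Complex.ext
      · simp [pow_two, ← h0]
      · simp [pow_two, ← h0]
    · exfalso
      -- `F(-conj s)` is the conjugate of `g(s²) - s h(s²)`. If `g` or `h` vanishes at `s²`, its
      -- modulus equals that of `F(s)`.
      have hlt := norm_eval_neg_conj_lt hFd hFr h0
      rw [hFe, hFe, neg_sq, ← map_pow, hconj, hconj, hs2] at hlt
      rcases hz with h1 | h1
      · simp [h1] at hlt
      · simp [h1] at hlt
  have hg0 : ∀ x : ℝ, g.IsRoot x → x < 0 := by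
    intro x hx
    obtain ⟨t, ht, hxt⟩ := hroot x (Or.inl (by rw [hre, hx.eq_zero, Complex.ofReal_zero]))
    have hxt' : x = t := by exact_mod_cast hxt
    rw [hxt'] at hx ⊢
    refine lt_of_le_of_ne ht ?_
    rintro rfl
    have := hE 0 le_rfl
    simp [hx.eq_zero] at this
  have hh0 : ∀ x : ℝ, h.IsRoot x → x < 0 := by
    intro x hx
    obtain ⟨t, ht, hxt⟩ := hroot x (Or.inr (by rw [hre, hx.eq_zero, Complex.ofReal_zero]))
    have hxt' : x = t := by exact_mod_cast hxt
    rw [hxt'] at hx ⊢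
    refine lt_of_le_of_ne ht ?_
    rintro rfl
    have := hE 0 le_rfl
    simp [hx.eq_zero] at this
  refine ⟨?_, ?_, ?_, ?_, ?_⟩
  · refine hasSimpleRealZeros_of_real_of_simple (fun z hz => hroot z (Or.inl hz)) ?_
    intro t ht h1 h2
    have := hE t ht
    simp [h1.eq_zero, h2] at this
  · refine hasSimpleRealZeros_of_real_of_simple (fun z hz => hroot z (Or.inr hz)) ?_
    intro t ht h1 h2
    have := hE t ht
    simp [h1.eq_zero, h2] at this
  · rintro z ⟨h1, h2⟩
    obtain ⟨t, ht, rfl⟩ := hroot z (Or.inl h1)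
    rw [hre] at h1 h2
    have := hE t ht
    rw [show g.eval t = 0 by exact_mod_cast h1, show h.eval t = 0 by exact_mod_cast h2] at this
    simp at this
  · exact oneZeroBetweenZeros_of_wronskian_ne_zero (ε := 1) (fun t ht => (hE t ht).ne') hg0
  · refine oneZeroBetweenZeros_of_wronskian_ne_zero (ε := -1) (fun t ht h0 => (hE t ht).ne' ?_) hh0
    linear_combination -h0

/-! ### Jacobi functionals and integration by parts -/

/-- The polynomial with complex conjugate coefficients. -/
noncomputable def conjPoly (p : ℂ[X]) : ℂ[X] := p.map (starRingEnd ℂ)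

@[simp] theorem conjPoly_mul (p q : ℂ[X]) : conjPoly (p * q) = conjPoly p * conjPoly q :=
  Polynomial.map_mul _
@[simp] theorem conjPoly_add (p q : ℂ[X]) : conjPoly (p + q) = conjPoly p + conjPoly q :=
  Polynomial.map_add _
@[simp] theorem conjPoly_sub (p q : ℂ[X]) : conjPoly (p - q) = conjPoly p - conjPoly q :=
  Polynomial.map_sub _
@[simp] theorem conjPoly_X : conjPoly X = X := Polynomial.map_X _
@[simp] theorem conjPoly_one : conjPoly 1 = 1 := Polynomial.map_one _
@[simp] theorem conjPoly_derivative (p : ℂ[X]) : conjPoly (derivative p) = derivative (conjPoly p) :=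
  (derivative_map p _).symm
@[simp] theorem conjPoly_conjPoly (p : ℂ[X]) : conjPoly (conjPoly p) = p := by
  ext n; simp [conjPoly]
@[simp] theorem coeff_conjPoly (p : ℂ[X]) (n : ℕ) :
    (conjPoly p).coeff n = starRingEnd ℂ (p.coeff n) := coeff_map _ _
theorem natDegree_conjPoly (p : ℂ[X]) : (conjPoly p).natDegree = p.natDegree :=
  natDegree_map_eq_of_injective (starRingEnd ℂ).injective p

/-- A linear functional with the properties of
`p ↦ ∫ t in 0..1, p t * t ^ α * (1 - t) ^ (β - 1)`. -/
structure IsJacobiFunctional (α β : ℝ) (J : ℂ[X] →ₗ[ℂ] ℂ) : Prop where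
  -- The argument times the weight is the derivative of `p t^(α+1) (1-t)^β`, which vanishes at both
  -- endpoints.
  ibp : ∀ p : ℂ[X], J (X * (1 - X) * derivative p +
    (C ((α + 1 : ℝ) : ℂ) * (1 - X) - C (β : ℂ) * X) * p) = 0
  pos : ∀ p : ℂ[X], p ≠ 0 → ∀ i j : ℕ, ∃ r : ℝ, 0 < r ∧
    J (X ^ i * (1 - X) ^ j * (p * conjPoly p)) = r
  conj : ∀ p : ℂ[X], J (conjPoly p) = starRingEnd ℂ (J p)

namespace IsJacobiFunctional

variable {α β : ℝ} {J : ℂ[X] →ₗ[ℂ] ℂ}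

theorem map_C_mul (c : ℂ) (p : ℂ[X]) : J (C c * p) = c * J p := by
  rw [← smul_eq_C_mul, map_smul, smul_eq_mul]

/-- The factor `1 - X` turns the weight of `J` into `t^α (1-t)^β`, for which the Jacobi polynomials
are orthogonal and their differential operator is symmetric. -/
theorem ibp_shift (hJ : IsJacobiFunctional α β J) (p : ℂ[X]) :
    J ((1 - X) * (X * (1 - X) * derivative p +
      (C ((α + 1 : ℝ) : ℂ) - C ((α + β + 2 : ℝ) : ℂ) * X) * p)) = 0 := by
  rw [← hJ.ibp ((1 - X) * p)]
  congr 1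
  simp only [derivative_mul, derivative_sub, derivative_one, derivative_X, zero_sub,
    Complex.ofReal_add, C_add, Complex.ofReal_one, Complex.ofReal_ofNat, C_1,
    show (C (2 : ℂ)) = 2 from rfl]
  ring

/-- Integrating the derivative of `|v|²` by parts turns twice the real part into `(1-α) ∫ (1-t)|v|²
+ β ∫ t|v|²`, against the weight of `J`. The exponent `β - 1` in that weight makes both integrands
polynomial. -/
theorem re_derivative_mul_conj_pos (hJ : IsJacobiFunctional α β J) (hα : α < 1) (hβ : 0 < β)
    {v : ℂ[X]} (hv : v ≠ 0) :
    0 < (J ((1 - X) * (derivative (X * v) * conjPoly v))).re := by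
  obtain ⟨r, hr, hr'⟩ := hJ.pos v hv 0 1
  obtain ⟨s, hs, hs'⟩ := hJ.pos v hv 1 0
  have h2 : J ((1 - X) * (derivative (X * v) * conjPoly v)) +
      starRingEnd ℂ (J ((1 - X) * (derivative (X * v) * conjPoly v))) =
      (((1 - α) * r + β * s : ℝ) : ℂ) := by
    rw [← hJ.conj, ← map_add]
    push_cast
    rw [← hr', ← hs', ← Complex.ofReal_one, ← Complex.ofReal_sub, ← map_C_mul, ← map_C_mul,
      ← map_add, ← sub_eq_zero, ← map_sub, ← hJ.ibp (v * conjPoly v)]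
    congr 1
    simp [derivative_mul]
    ring
  rw [Complex.add_conj] at h2
  have h3 : 2 * (J ((1 - X) * (derivative (X * v) * conjPoly v))).re = (1 - α) * r + β * s := by
    exact_mod_cast h2
  nlinarith [mul_pos (sub_pos.2 hα) hr, mul_pos hβ hs]

/-- The same computation with `t|v|²` gives `-α ∫ t(1-t)|v|² + β ∫ t²|v|²`, hence the need for `α <
0`. -/
theorem re_derivative_mul_conj_self_pos (hJ : IsJacobiFunctional α β J) (hα : α < 0) (hβ : 0 < β)
    {v : ℂ[X]} (hv : v ≠ 0) :
    0 < (J ((1 - X) * (derivative (X * v) * conjPoly (X * v)))).re := by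
  obtain ⟨r, hr, hr'⟩ := hJ.pos v hv 1 1
  obtain ⟨s, hs, hs'⟩ := hJ.pos v hv 2 0
  have h2 : J ((1 - X) * (derivative (X * v) * conjPoly (X * v))) +
      starRingEnd ℂ (J ((1 - X) * (derivative (X * v) * conjPoly (X * v)))) =
      ((-α * r + β * s : ℝ) : ℂ) := by
    rw [← hJ.conj, ← map_add]
    push_cast
    rw [← hr', ← hs', ← Complex.ofReal_neg, ← map_C_mul, ← map_C_mul,
      ← map_add, ← sub_eq_zero, ← map_sub, ← hJ.ibp (X * (v * conjPoly v))]
    congr 1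
    simp [derivative_mul]
    ring
  rw [Complex.add_conj] at h2
  have h3 : 2 * (J ((1 - X) * (derivative (X * v) * conjPoly (X * v)))).re = -α * r + β * s := by
    exact_mod_cast h2
  nlinarith [mul_pos (neg_pos.2 hα) hr, mul_pos hβ hs]

end IsJacobiFunctional

/-! ### Orthogonality and the two nonvanishing arguments -/

/-- `H` is a real solution of the hypergeometric equation of degree `n`, in the variable
`t = (1 - x) / 2`. -/
structure IsJacobiSolution (α β : ℝ) (n : ℕ) (H : ℂ[X]) : Prop where
  natDegree_le : H.natDegree ≤ n
  real : conjPoly H = H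
  ode : X * (1 - X) * derivative (derivative H) +
    (C ((α + 1 : ℝ) : ℂ) - C ((α + β + 2 : ℝ) : ℂ) * X) * derivative H +
      C ((n * (n + α + β + 1) : ℝ) : ℂ) * H = 0

namespace IsJacobiSolution

variable {α β : ℝ} {J : ℂ[X] →ₗ[ℂ] ℂ} {n : ℕ} {H : ℂ[X]}

/-- Symmetry of the Jacobi operator `L` gives the induction: `L X^(m+1)` is a combination of
`X^(m+1)` and `X^m`, and its `X^(m+1)` coefficient differs from the eigenvalue of `H` while `m + 1 <
n`. -/
theorem functional_mul_X_pow (hH : IsJacobiSolution α β n H) (hJ : IsJacobiFunctional α β J)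
    (hαβ : -1 < α + β) (m : ℕ) (hm : m < n) : J ((1 - X) * (H * X ^ m)) = 0 := by
  induction m with
  | zero =>
    have h := hJ.ibp_shift (derivative H)
    have e : (1 - X) * (X * (1 - X) * derivative (derivative H) +
        (C ((α + 1 : ℝ) : ℂ) - C ((α + β + 2 : ℝ) : ℂ) * X) * derivative H) =
        C (-((n * (n + α + β + 1) : ℝ) : ℂ)) * ((1 - X) * (H * X ^ 0)) := by
      rw [C_neg]
      linear_combination (1 - X) * hH.ode
    rw [e, IsJacobiFunctional.map_C_mul] at h
    refine (mul_eq_zero.1 h).resolve_left (?_ : (_ : ℂ) ≠ 0)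
    rw [neg_ne_zero, Complex.ofReal_ne_zero]
    have : (0 : ℝ) < n := by exact_mod_cast hm
    have h3 : 0 < (n : ℝ) + α + β + 1 := by linarith
    positivity
  | succ m ih =>
    -- Lagrange's identity: integrating this bracket by parts leaves `X^(m+1) L H - H L X^(m+1)`.
    have h := hJ.ibp_shift (derivative H * X ^ (m + 1) - H * derivative (X ^ (m + 1)))
    have e : (1 - X) * (X * (1 - X) *
        derivative (derivative H * X ^ (m + 1) - H * derivative (X ^ (m + 1))) +
        (C ((α + 1 : ℝ) : ℂ) - C ((α + β + 2 : ℝ) : ℂ) * X) *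
          (derivative H * X ^ (m + 1) - H * derivative (X ^ (m + 1)))) =
        C ((((m + 1) * (m + 2 + α + β) - n * (n + α + β + 1) : ℝ)) : ℂ) *
          ((1 - X) * (H * X ^ (m + 1))) -
        C (((m + 1) * (m + 1 + α) : ℝ) : ℂ) * ((1 - X) * (H * X ^ m)) := by
      have h2 : X * derivative (derivative (X ^ (m + 1) : ℂ[X])) = C ((m + 1) * m : ℂ) * X ^ m := by
        rcases m with _ | m
        · simp
        · simp [derivative_mul]
          ring
      have h3 : X ^ (m + 1) = X * (X ^ m : ℂ[X]) := by ring
      have h1 : derivative (X ^ (m + 1) : ℂ[X]) = C (m + 1 : ℂ) * X ^ m := by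
        simp
      have hode := hH.ode
      simp only [derivative_sub, derivative_mul] at *
      rw [show X * (1 - X) * (derivative (derivative H) * X ^ (m + 1) + derivative H *
        derivative (X ^ (m + 1)) - (derivative H * derivative (X ^ (m + 1)) +
        H * derivative (derivative (X ^ (m + 1))))) = X * (1 - X) *
        (derivative (derivative H) * X ^ (m + 1)) - (1 - X) * H *
        (X * derivative (derivative (X ^ (m + 1)))) by ring, h2, h1, h3]
      simp only [Complex.ofReal_add, Complex.ofReal_mul, Complex.ofReal_sub, C_sub, C_add, C_mul,
        Complex.ofReal_one, Complex.ofReal_ofNat, C_1, Complex.ofReal_natCast,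
        show (C (2 : ℂ)) = 2 from rfl] at *
      linear_combination (1 - X) * (X * X ^ m) * hode
    rw [e, map_sub, IsJacobiFunctional.map_C_mul, IsJacobiFunctional.map_C_mul,
      ih (by omega), mul_zero, sub_zero] at h
    refine (mul_eq_zero.1 h).resolve_left (?_ : (_ : ℂ) ≠ 0)
    rw [Complex.ofReal_ne_zero]
    have h4 : (m : ℝ) + 1 < n := by exact_mod_cast hm
    have h5 : (0 : ℝ) ≤ m := Nat.cast_nonneg m
    nlinarith [mul_pos (sub_pos.2 h4) (show 0 < (n : ℝ) + m + 2 + α + β by linarith)]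

theorem functional_mul (hH : IsJacobiSolution α β n H) (hJ : IsJacobiFunctional α β J)
    (hαβ : -1 < α + β) (q : ℂ[X]) (hq : q.natDegree ≤ n) :
    J ((1 - X) * (H * q)) = q.coeff n * J ((1 - X) * (H * X ^ n)) := by
  conv_lhs => rw [q.as_sum_range_C_mul_X_pow' (n := n + 1) (by omega), Finset.sum_range_succ,
    mul_add, mul_add, Finset.mul_sum, Finset.mul_sum, map_add, map_sum]
  rw [Finset.sum_eq_zero, zero_add, ← IsJacobiFunctional.map_C_mul]
  · congr 1; ring
  · intro m hm
    rw [show (1 - X) * (H * (C (q.coeff m) * X ^ m)) =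
      C (q.coeff m) * ((1 - X) * (H * X ^ m)) by ring, IsJacobiFunctional.map_C_mul,
      hH.functional_mul_X_pow hJ hαβ m (Finset.mem_range.1 hm), mul_zero]

theorem exists_coeff_mul_functional_eq (hH : IsJacobiSolution α β n H)
    (hJ : IsJacobiFunctional α β J) (hαβ : -1 < α + β) (h0 : H ≠ 0) :
    ∃ r : ℝ, 0 < r ∧ H.coeff n * J ((1 - X) * (H * X ^ n)) = r := by
  obtain ⟨r, hr, hr'⟩ := hJ.pos H h0 0 1
  refine ⟨r, hr, ?_⟩
  rw [← hH.functional_mul hJ hαβ H hH.natDegree_le, ← hr', hH.real]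
  simp

variable {G U : ℂ[X]} {A h g : ℝ} {ζ : ℂ}

/-- The leading coefficient `g` times the `n`-th moment is `∫ G² > 0`, so the moment has the sign of
`g`, opposite to that of `h`. -/
theorem exists_functional_eq (hG : IsJacobiSolution α β n G)
    (hJ : IsJacobiFunctional α β J) (hαβ : -1 < α + β)
    (hg : G.coeff n = g) (hhg : h * g < 0) :
    ∃ r : ℝ, h * r < 0 ∧ J ((1 - X) * (G * X ^ n)) = r := by
  have hg0 : g ≠ 0 := by rintro rfl; simp at hhg
  have hG0 : G ≠ 0 := by
    rintro rfl
    simp at hg; exact hg0 (by exact_mod_cast hg.symm)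
  obtain ⟨r, hr, hr'⟩ := hG.exists_coeff_mul_functional_eq hJ hαβ hG0
  have hgc : (g : ℂ) ≠ 0 := by exact_mod_cast hg0
  refine ⟨r / g, ?_, ?_⟩
  · have : h * (r / g) = (h * g) * (r / g ^ 2) := by field_simp
    rw [this]
    exact mul_neg_of_neg_of_pos hhg (by positivity)
  · rw [hg] at hr'
    rw [Complex.ofReal_div, ← hr']
    field_simp

theorem eval_zero_ne_zero_of_shift_lower (hH : IsJacobiSolution α β (n + 1) H)
    (hG : IsJacobiSolution α β n G)
    (hJ : IsJacobiFunctional α β J) (hα : -1 < α) (hα' : α < 1) (hβ : 0 < β)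
    (hh : H.coeff (n + 1) = h) (hg : G.coeff n = g) (hhg : h * g < 0) (hA : 0 < A)
    (hζ : ζ ≠ 0) (hζ' : 0 ≤ ζ.re) (hUd : U.natDegree ≤ n + 1)
    (hU : U + C ζ * derivative U = C (A : ℂ) * H + C (2 * ζ) * G) : U.eval 0 ≠ 0 := by
  intro h0
  have hαβ : -1 < α + β := by linarith
  obtain ⟨r, hr, hr'⟩ := hG.exists_functional_eq hJ hαβ hg hhg
  obtain ⟨v, hv⟩ : X ∣ U := by rw [X_dvd_iff, coeff_zero_eq_eval_zero, h0]
  have hvd : v.natDegree ≤ n := by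
    by_cases hv' : v = 0
    · simp [hv']
    · rw [hv, natDegree_X_mul hv'] at hUd; omega
  have hUc : U.coeff (n + 1) = A * h := by
    have := congrArg (fun p => p.coeff (n + 1)) hU
    simpa [-map_mul, coeff_derivative, hh,
      coeff_eq_zero_of_natDegree_lt (lt_of_le_of_lt hUd (n + 1).lt_succ_self),
      coeff_eq_zero_of_natDegree_lt (lt_of_le_of_lt hG.natDegree_le n.lt_succ_self)] using this
  have hvc : v.coeff n = A * h := by rw [← hUc, hv, coeff_X_mul]
  have hh0 : h ≠ 0 := by rintro rfl; simp at hhg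
  have hv0 : v ≠ 0 := by
    intro hv'
    rw [hv', coeff_zero] at hvc
    have : A * h = 0 := by exact_mod_cast hvc.symm
    exact (mul_ne_zero hA.ne' hh0) this
  have hpos := hJ.re_derivative_mul_conj_pos hα' hβ hv0
  rw [← hv] at hpos
  obtain ⟨s, hs, hs'⟩ := hJ.pos v hv0 1 1
  have hvd' : (conjPoly v).natDegree ≤ n := by rwa [natDegree_conjPoly]
  have h1 : J ((1 - X) * (H * conjPoly v)) = 0 := by
    rw [hH.functional_mul hJ hαβ _ (by omega),
      coeff_eq_zero_of_natDegree_lt (by omega), zero_mul]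
  have h2 : J ((1 - X) * (G * conjPoly v)) = ((A * (h * r) : ℝ) : ℂ) := by
    rw [hG.functional_mul hJ hαβ _ hvd', coeff_conjPoly, hvc, hr']
    simp [mul_assoc]
  -- The equation for `U`, multiplied by `(1 - X) conj v`.
  have e : X ^ 1 * (1 - X) ^ 1 * (v * conjPoly v) +
      C ζ * ((1 - X) * (derivative U * conjPoly v)) = C (A : ℂ) * ((1 - X) * (H * conjPoly v)) +
        C (2 * ζ) * ((1 - X) * (G * conjPoly v)) := by
    linear_combination (1 - X) * conjPoly v * hU - (1 - X) * conjPoly v * hv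
  have h3 := congrArg J e
  rw [map_add, map_add, IsJacobiFunctional.map_C_mul, IsJacobiFunctional.map_C_mul,
    IsJacobiFunctional.map_C_mul, hs', h1, h2, mul_zero, zero_add] at h3
  -- After division by `ζ`, every term on the right has nonpositive real part, because `h r < 0` and
  -- `Re ζ⁻¹ ≥ 0`.
  have h4 : J ((1 - X) * (derivative U * conjPoly v)) =
      ((2 * (A * (h * r)) : ℝ) : ℂ) - (s : ℝ) * ζ⁻¹ := by
    field_simp
    push_cast at h3 ⊢
    linear_combination h3
  rw [h4, Complex.sub_re, Complex.ofReal_re, Complex.re_ofReal_mul, Complex.inv_re] at hpos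
  have h5 : 0 ≤ s * (ζ.re / Complex.normSq ζ) :=
    mul_nonneg hs.le (div_nonneg hζ' (Complex.normSq_nonneg _))
  nlinarith [mul_pos hA (neg_pos.2 hr)]

theorem eval_zero_ne_zero_of_shift_upper (hH : IsJacobiSolution α β (n + 1) H)
    (hG : IsJacobiSolution α β n G)
    (hJ : IsJacobiFunctional α β J) (hα : -1 < α) (hα' : α < 0) (hβ : 0 < β)
    (hh : H.coeff (n + 1) = h) (hg : G.coeff n = g) (hhg : h * g < 0) (hA : 0 < A)
    (hζ : ζ ≠ 0) (hζ' : 0 ≤ ζ.re) (hUd : U.natDegree ≤ n + 1)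
    (hU : U + C ζ * derivative U = C (2 * ζ) * H + C (A : ℂ) * G) : U.eval 0 ≠ 0 := by
  intro h0
  have hαβ : -1 < α + β := by linarith
  obtain ⟨r, hr, hr'⟩ := hG.exists_functional_eq hJ hαβ hg hhg
  have hh0 : h ≠ 0 := by rintro rfl; simp at hhg
  have hUc : U.coeff (n + 1) = 2 * ζ * h := by
    have := congrArg (fun p => p.coeff (n + 1)) hU
    simpa [-map_mul, coeff_derivative, hh,
      coeff_eq_zero_of_natDegree_lt (lt_of_le_of_lt hUd (n + 1).lt_succ_self),
      coeff_eq_zero_of_natDegree_lt (lt_of_le_of_lt hG.natDegree_le n.lt_succ_self)] using this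
  -- Here the leading coefficient of `U` carries a factor `ζ`; paired with `G`, the conjugate of
  -- `U'` thus contributes `conj ζ`, whose real part is nonnegative.
  have hc0 : (2 * ζ * h : ℂ) ≠ 0 := by simp [hζ, hh0]
  obtain ⟨v, hv⟩ : X ∣ U := by rw [X_dvd_iff, coeff_zero_eq_eval_zero, h0]
  have hv0 : v ≠ 0 := by
    rintro rfl
    rw [hv, mul_zero, coeff_zero] at hUc
    exact hc0 hUc.symm
  have hdc : (derivative U).coeff n = 2 * ζ * h * (n + 1) := by rw [coeff_derivative, hUc]
  have hd0 : derivative U ≠ 0 := by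
    intro h
    rw [h, coeff_zero] at hdc
    exact mul_ne_zero hc0 (Nat.cast_add_one_ne_zero n) hdc.symm
  have hpos := hJ.re_derivative_mul_conj_self_pos hα' hβ hv0
  rw [← hv] at hpos
  obtain ⟨s, hs, hs'⟩ := hJ.pos _ hd0 0 1
  have hdd : (conjPoly (derivative U)).natDegree ≤ n := by
    rw [natDegree_conjPoly]
    have := natDegree_derivative_le U
    omega
  have h1 : J ((1 - X) * (H * conjPoly (derivative U))) = 0 := by
    rw [hH.functional_mul hJ hαβ _ (by omega),
      coeff_eq_zero_of_natDegree_lt (by omega), zero_mul]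
  have h2 : J ((1 - X) * (G * conjPoly (derivative U))) =
      ((2 * (h * r) * (n + 1) : ℝ) : ℂ) * starRingEnd ℂ ζ := by
    rw [hG.functional_mul hJ hαβ _ hdd, coeff_conjPoly, hdc, hr']
    simp [Complex.conj_ofNat]
    ring
  -- The equation for `U`, multiplied by `(1 - X) conj U'`; the first term is conjugated to expose
  -- `∫ U' conj U`.
  have e : conjPoly ((1 - X) * (derivative U * conjPoly U)) +
      C ζ * (X ^ 0 * (1 - X) ^ 1 * (derivative U * conjPoly (derivative U))) =
      C (2 * ζ) * ((1 - X) * (H * conjPoly (derivative U))) +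
        C (A : ℂ) * ((1 - X) * (G * conjPoly (derivative U))) := by
    simp only [conjPoly_mul, conjPoly_sub, conjPoly_one, conjPoly_X, conjPoly_derivative,
      conjPoly_conjPoly]
    linear_combination (1 - X) * derivative (conjPoly U) * hU
  have h3 := congrArg J e
  rw [map_add, map_add, IsJacobiFunctional.map_C_mul, IsJacobiFunctional.map_C_mul,
    IsJacobiFunctional.map_C_mul, hs', h1, h2, mul_zero, zero_add, hJ.conj,
    ← mul_assoc (A : ℂ), ← Complex.ofReal_mul, mul_comm ζ] at h3
  have h4 := congrArg Complex.re h3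
  rw [Complex.add_re, Complex.conj_re, Complex.re_ofReal_mul, Complex.re_ofReal_mul,
    Complex.conj_re] at h4
  have h5 : 0 ≤ s * ζ.re := mul_nonneg hs.le hζ'
  have h6 : A * (2 * (h * r) * (n + 1)) * ζ.re ≤ 0 := by
    refine mul_nonpos_of_nonpos_of_nonneg ?_ hζ'
    refine mul_nonpos_of_nonneg_of_nonpos hA.le (mul_nonpos_of_nonpos_of_nonneg ?_ (by positivity))
    linarith
  linarith

end IsJacobiSolution

/-! ### Realization of the functional by a weighted integral -/

/-- The weight `t ^ a * (1 - t) ^ b`. -/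
noncomputable def jacobiWeight (a b t : ℝ) : ℝ := t ^ a * (1 - t) ^ b

theorem jacobiWeight_pos (a b : ℝ) {t : ℝ} (ht : t ∈ Set.Ioo (0 : ℝ) 1) :
    0 < jacobiWeight a b t :=
  mul_pos (Real.rpow_pos_of_pos ht.1 _) (Real.rpow_pos_of_pos (sub_pos.2 ht.2) _)

theorem intervalIntegrable_jacobiWeight {a b : ℝ} (ha : -1 < a) (hb : -1 < b) :
    IntervalIntegrable (jacobiWeight a b) MeasureTheory.volume 0 1 := by
  have h := (Complex.betaIntegral_convergent (u := (a + 1 : ℝ)) (v := (b + 1 : ℝ))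
    (by simpa using by linarith) (by simpa using by linarith)).norm
  refine h.congr ?_
  intro t ht
  rw [Set.uIoc_of_le zero_le_one] at ht
  have h0 : 0 ≤ 1 - t := by linarith [ht.2]
  have e1 : ((a + 1 : ℝ) : ℂ) - 1 = (a : ℝ) := by push_cast; ring
  have e2 : ((b + 1 : ℝ) : ℂ) - 1 = (b : ℝ) := by push_cast; ring
  simp only [jacobiWeight]
  rw [e1, e2, norm_mul, ← Complex.ofReal_one, ← Complex.ofReal_sub, ← Complex.ofReal_cpow ht.1.le,
    ← Complex.ofReal_cpow h0, Complex.norm_real, Complex.norm_real, Real.norm_eq_abs,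
    Real.norm_eq_abs, abs_of_nonneg (Real.rpow_nonneg ht.1.le _),
    abs_of_nonneg (Real.rpow_nonneg h0 _)]

theorem intervalIntegrable_eval_mul_jacobiWeight {a b : ℝ} (ha : -1 < a) (hb : -1 < b)
    (p : ℂ[X]) : IntervalIntegrable (fun t : ℝ => p.eval (t : ℂ) * (jacobiWeight a b t : ℂ))
      MeasureTheory.volume 0 1 := by
  have h : IntervalIntegrable (fun t => (jacobiWeight a b t : ℂ)) MeasureTheory.volume 0 1 :=
    ⟨(intervalIntegrable_jacobiWeight ha hb).1.ofReal,
      (intervalIntegrable_jacobiWeight ha hb).2.ofReal⟩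
  exact h.continuousOn_mul (by fun_prop)

/-- Integration of polynomials on `[0, 1]` against the weight `t ^ a * (1 - t) ^ b`. -/
noncomputable def jacobiIntegral {a b : ℝ} (ha : -1 < a) (hb : -1 < b) : ℂ[X] →ₗ[ℂ] ℂ where
  toFun p := ∫ t in (0 : ℝ)..1, p.eval (t : ℂ) * (jacobiWeight a b t : ℂ)
  map_add' p q := by
    simp only [eval_add, add_mul]
    exact intervalIntegral.integral_add (intervalIntegrable_eval_mul_jacobiWeight ha hb p)
      (intervalIntegrable_eval_mul_jacobiWeight ha hb q)
  map_smul' c p := by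
    simp only [eval_smul, smul_eq_mul, mul_assoc, RingHom.id_apply]
    exact intervalIntegral.integral_const_mul c _

theorem jacobiIntegral_apply {a b : ℝ} (ha : -1 < a) (hb : -1 < b) (p : ℂ[X]) :
    jacobiIntegral ha hb p = ∫ t in (0 : ℝ)..1, p.eval (t : ℂ) * (jacobiWeight a b t : ℂ) := rfl

theorem jacobiIntegral_ibp {a b : ℝ} (ha : -1 < a) (hb : -1 < b) (p : ℂ[X]) :
    jacobiIntegral ha hb (X * (1 - X) * derivative p +
      (C ((a + 1 : ℝ) : ℂ) * (1 - X) - C ((b + 1 : ℝ) : ℂ) * X) * p) = 0 := by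
  rw [jacobiIntegral_apply, intervalIntegral.integral_eq_sub_of_hasDerivAt_of_le zero_le_one
    (f := fun t : ℝ => p.eval (t : ℂ) * ((t ^ (a + 1) * (1 - t) ^ (b + 1) : ℝ) : ℂ))]
  · simp [Real.zero_rpow (show a + 1 ≠ 0 by linarith), Real.zero_rpow (show b + 1 ≠ 0 by linarith)]
  · refine ContinuousOn.mul (by fun_prop) (Complex.continuous_ofReal.comp_continuousOn ?_)
    refine ContinuousOn.mul (continuousOn_id.rpow_const fun _ _ => Or.inr (by linarith)) ?_
    exact ContinuousOn.rpow_const (by fun_prop) fun _ _ => Or.inr (by linarith)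
  · intro t ht
    have ht0 : t ≠ 0 := ht.1.ne'
    have ht1 : 1 - t ≠ 0 := (sub_pos.2 ht.2).ne'
    have h1 : HasDerivAt (fun t : ℝ => 1 - t) (-1) t := by
      simpa using (hasDerivAt_id t).const_sub 1
    have hw := ((hasDerivAt_id t).rpow_const (p := a + 1) (Or.inl ht0)).mul
      (h1.rpow_const (p := b + 1) (Or.inl ht1))
    have hp : HasDerivAt (fun t : ℝ => p.eval (t : ℂ)) (p.derivative.eval (t : ℂ)) t :=
      (p.hasDerivAt (t : ℂ)).comp_ofReal
    refine (hp.mul hw.ofReal_comp).congr_deriv ?_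
    simp only [Pi.mul_apply, id, add_sub_cancel_right, Real.rpow_add_one ht0,
      Real.rpow_add_one ht1, jacobiWeight]
    simp
    ring
  · exact intervalIntegrable_eval_mul_jacobiWeight ha hb _

theorem jacobiIntegral_pos {a b : ℝ} (ha : -1 < a) (hb : -1 < b) {q : ℂ[X]} (hq : q ≠ 0)
    (f : ℝ → ℝ) (hf : ∀ t : ℝ, q.eval (t : ℂ) = f t) (hf0 : ∀ t ∈ Set.Ioo (0 : ℝ) 1, 0 ≤ f t) :
    ∃ r : ℝ, 0 < r ∧ jacobiIntegral ha hb q = r := by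
  have hi := intervalIntegrable_eval_mul_jacobiWeight ha hb q
  have e : (fun t : ℝ => q.eval (t : ℂ) * (jacobiWeight a b t : ℂ)) =
      fun t => ((f t * jacobiWeight a b t : ℝ) : ℂ) := by
    ext t; rw [hf]; push_cast; rfl
  refine ⟨∫ t in (0 : ℝ)..1, f t * jacobiWeight a b t, ?_, ?_⟩
  · have hi' : IntervalIntegrable (fun t => f t * jacobiWeight a b t) MeasureTheory.volume 0 1 := by
      rw [e] at hi
      exact ⟨by simpa [MeasureTheory.IntegrableOn] using hi.1.re, by simp⟩
    have hae : ∀ᵐ t ∂(MeasureTheory.volume.restrict (Set.uIoc (0 : ℝ) 1)),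
        t ∈ Set.Ioo (0 : ℝ) 1 := by
      rw [Set.uIoc_of_le zero_le_one, MeasureTheory.restrict_Ioo_eq_restrict_Ioc.symm]
      exact MeasureTheory.ae_restrict_mem measurableSet_Ioo
    rw [intervalIntegral.integral_pos_iff_support_of_nonneg_ae' _ hi']
    · refine ⟨zero_lt_one, ?_⟩
      have hfin : {t : ℝ | q.eval (t : ℂ) = 0}.Finite := by
        refine Set.Finite.subset ((q.roots.toFinset.finite_toSet).preimage
          (Complex.ofReal_injective.injOn)) ?_
        intro t ht
        simpa [hq] using ht
      -- The integrand vanishes inside the interval only at the finitely many zeros of `q`.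
      have hsub : Set.Ioo (0 : ℝ) 1 \ {t : ℝ | q.eval (t : ℂ) = 0} ⊆
          Function.support (fun t => f t * jacobiWeight a b t) ∩ Set.Ioc 0 1 := by
        rintro t ⟨ht, htq⟩
        refine ⟨mul_ne_zero ?_ (jacobiWeight_pos a b ht).ne', ht.1, ht.2.le⟩
        intro h
        apply htq
        simp [hf, h]
      refine lt_of_lt_of_le ?_ (MeasureTheory.measure_mono hsub)
      rw [MeasureTheory.measure_sdiff_null (hfin.measure_zero _)]
      simp
    · filter_upwards [hae] with t ht
      exact mul_nonneg (hf0 t ht) (jacobiWeight_pos a b ht).le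
  · rw [jacobiIntegral_apply, e]
    exact intervalIntegral.integral_ofReal

theorem eval_conjPoly_ofReal (p : ℂ[X]) (t : ℝ) :
    (conjPoly p).eval (t : ℂ) = starRingEnd ℂ (p.eval (t : ℂ)) := by
  rw [conjPoly, eval_map, ← eval₂_at_apply, Complex.conj_ofReal]

theorem isJacobiFunctional_jacobiIntegral {α β : ℝ} (hα : -1 < α) (hβ : -1 < β - 1) :
    IsJacobiFunctional α β (jacobiIntegral hα hβ) where
  ibp p := by
    have := jacobiIntegral_ibp hα hβ p
    rwa [sub_add_cancel] at this
  pos p hp i j := by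
    have h1 : (1 - X : ℂ[X]) ≠ 0 := by
      intro h
      have := congrArg (eval 0) h
      simp at this
    have hc : conjPoly p ≠ 0 := by
      intro h
      apply hp
      rw [← conjPoly_conjPoly p, h]
      simp [conjPoly]
    refine jacobiIntegral_pos hα hβ (mul_ne_zero (mul_ne_zero (pow_ne_zero _ X_ne_zero)
      (pow_ne_zero _ h1)) (mul_ne_zero hp hc))
      (fun t => t ^ i * (1 - t) ^ j * Complex.normSq (p.eval (t : ℂ))) ?_ ?_
    · intro t
      simp [eval_conjPoly_ofReal, Complex.mul_conj]
    · intro t ht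
      have := sub_pos.2 ht.2
      have h2 := ht.1
      have := Complex.normSq_nonneg (p.eval (t : ℂ))
      positivity
  conj p := by
    rw [jacobiIntegral_apply, jacobiIntegral_apply, ← intervalIntegral.intervalIntegral_conj]
    congr 1
    ext t
    simp [eval_conjPoly_ofReal]

/-! ### Jacobi polynomials in the variable `t = (1 - x)/2` -/

/-- The coefficients of the Jacobi polynomial in powers of `(1 - x) / 2`. -/
noncomputable def jacobiCoeff (n : ℕ) (α β : ℝ) (k : ℕ) : ℝ :=
  (ascPochhammer ℝ n).eval (α + 1) / (n.factorial : ℝ) *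
    ((ascPochhammer ℝ k).eval (-(n : ℝ)) * (ascPochhammer ℝ k).eval ((n : ℝ) + α + β + 1) /
      ((k.factorial : ℝ) * (ascPochhammer ℝ k).eval (α + 1)))

/-- The Jacobi polynomial in the variable `t = (1 - x) / 2`. -/
noncomputable def shiftedJacobi (n : ℕ) (α β : ℝ) : ℝ[X] :=
  ∑ k ∈ Finset.range (n + 1), C (jacobiCoeff n α β k) * X ^ k

theorem jacobiPoly_eq_comp (n : ℕ) (α β : ℝ) :
    jacobiPoly n α β = (shiftedJacobi n α β).comp (C (1 / 2 : ℝ) * (1 - X)) := by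
  rw [jacobiPoly, shiftedJacobi, ← coe_compRingHom_apply, map_sum, Finset.mul_sum]
  refine Finset.sum_congr rfl fun k _ => ?_
  rw [coe_compRingHom_apply, mul_comp, C_comp, X_pow_comp, jacobiCoeff, C_mul, mul_assoc]

theorem jacobiCoeff_of_lt {n k : ℕ} (h : n < k) (α β : ℝ) : jacobiCoeff n α β k = 0 := by
  rw [jacobiCoeff, ascPochhammer_eval_neg_coe_nat_of_lt h]
  simp

theorem coeff_shiftedJacobi (n : ℕ) (α β : ℝ) (k : ℕ) :
    (shiftedJacobi n α β).coeff k = jacobiCoeff n α β k := by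
  rw [shiftedJacobi, finsetSum_coeff]
  simp only [coeff_C_mul, coeff_X_pow]
  rcases lt_or_ge n k with h | h
  · rw [jacobiCoeff_of_lt h]
    refine Finset.sum_eq_zero fun i hi => ?_
    rw [Finset.mem_range] at hi
    rw [if_neg (by omega), mul_zero]
  · simp [Nat.lt_succ_iff.2 h]

theorem natDegree_shiftedJacobi_le (n : ℕ) (α β : ℝ) : (shiftedJacobi n α β).natDegree ≤ n := by
  rw [natDegree_le_iff_coeff_eq_zero]
  intro k hk
  rw [coeff_shiftedJacobi, jacobiCoeff_of_lt hk]

theorem jacobiCoeff_zero_pos (n : ℕ) {α : ℝ} (hα : -1 < α) (β : ℝ) : 0 < jacobiCoeff n α β 0 := by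
  have := ascPochhammer_pos n (α + 1) (by linarith)
  have h2 : (0 : ℝ) < n.factorial := by exact_mod_cast n.factorial_pos
  simp [jacobiCoeff]
  positivity

theorem jacobiCoeff_succ (n : ℕ) {α : ℝ} (hα : -1 < α) (β : ℝ) (k : ℕ) :
    jacobiCoeff n α β (k + 1) * ((k + 1) * (k + 1 + α)) =
      jacobiCoeff n α β k * ((k - n) * (k + n + α + β + 1)) := by
  have h1 := (ascPochhammer_pos k (α + 1) (by linarith)).ne'
  have h2 : (k.factorial : ℝ) ≠ 0 := by exact_mod_cast k.factorial_ne_zero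
  have h3 : (n.factorial : ℝ) ≠ 0 := by exact_mod_cast n.factorial_ne_zero
  have h4 : (k : ℝ) + 1 ≠ 0 := by positivity
  have h5 : α + 1 + k ≠ 0 := by
    have : (0 : ℝ) ≤ k := Nat.cast_nonneg k
    linarith
  rw [jacobiCoeff, jacobiCoeff, ascPochhammer_succ_eval, ascPochhammer_succ_eval,
    ascPochhammer_succ_eval, Nat.factorial_succ]
  push_cast
  field_simp
  ring

theorem exists_jacobiCoeff_self_eq (n : ℕ) {α β : ℝ} (hα : -1 < α) (hαβ : -1 < α + β) :
    ∃ r : ℝ, 0 < r ∧ jacobiCoeff n α β n = (-1) ^ n * r := by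
  have h1 := ascPochhammer_pos n (α + 1) (by linarith)
  have h0 : (0 : ℝ) ≤ n := Nat.cast_nonneg n
  have h2 := ascPochhammer_pos n ((n : ℝ) + α + β + 1) (by linarith)
  have h3 : (0 : ℝ) < n.factorial := by exact_mod_cast n.factorial_pos
  refine ⟨(ascPochhammer ℝ n).eval ((n : ℝ) + α + β + 1) / n.factorial, by positivity, ?_⟩
  rw [jacobiCoeff, ascPochhammer_eval_neg_eq_descPochhammer, descPochhammer_eval_eq_descFactorial,
    Nat.descFactorial_self]
  field_simp

theorem derivative_shiftedJacobi (n : ℕ) {α : ℝ} (hα : -1 < α) (β : ℝ) :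
    derivative (shiftedJacobi (n + 1) α β) =
      C (-((n : ℝ) + 1 + α + β + 1)) * shiftedJacobi n (α + 1) (β + 1) := by
  ext k
  have h1 := (ascPochhammer_pos k (α + 1 + 1) (by linarith)).ne'
  have h2 : (k.factorial : ℝ) ≠ 0 := by exact_mod_cast k.factorial_ne_zero
  have h3 : (n.factorial : ℝ) ≠ 0 := by exact_mod_cast n.factorial_ne_zero
  have h4 : (k : ℝ) + 1 ≠ 0 := by positivity
  have h5 : (n : ℝ) + 1 ≠ 0 := by positivity
  have h6 : α + 1 ≠ 0 := by linarith
  have hs : ∀ (m : ℕ) (x : ℝ), (ascPochhammer ℝ (m + 1)).eval x =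
      x * (ascPochhammer ℝ m).eval (x + 1) := by
    intro m x
    rw [ascPochhammer_succ_left]
    simp [eval_comp]
  rw [coeff_derivative, coeff_C_mul, coeff_shiftedJacobi, coeff_shiftedJacobi, jacobiCoeff,
    jacobiCoeff, hs, hs, hs, hs, Nat.factorial_succ, Nat.factorial_succ]
  push_cast
  rw [show -((n : ℝ) + 1) + 1 = -n by ring,
    show (n : ℝ) + 1 + α + β + 1 + 1 = n + (α + 1) + (β + 1) + 1 by ring]
  field_simp

theorem shiftedJacobi_ode (n : ℕ) {α : ℝ} (hα : -1 < α) (β : ℝ) :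
    X * (1 - X) * derivative (derivative (shiftedJacobi n α β)) +
      (C (α + 1) - C (α + β + 2) * X) * derivative (shiftedJacobi n α β) +
        C (n * (n + α + β + 1)) * shiftedJacobi n α β = 0 := by
  set H := shiftedJacobi n α β with hH
  have hX : ∀ (p : ℝ[X]) (k : ℕ), (X * derivative p).coeff k = k * p.coeff k := by
    intro p k
    rcases k with _ | k
    · simp
    · rw [coeff_X_mul, coeff_derivative]; push_cast; ring
  -- Rewriting through the Euler operator `X d/dX`, which multiplies the `k`-th coefficient by `k`,
  -- reduces the equation to the coefficient recurrence.
  have e : X * (1 - X) * derivative (derivative H) +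
      (C (α + 1) - C (α + β + 2) * X) * derivative H + C (n * (n + α + β + 1)) * H =
      X * derivative (derivative H) - X * derivative (X * derivative H) + X * derivative H +
      C (α + 1) * derivative H - C (α + β + 2) * (X * derivative H) +
        C (n * (n + α + β + 1)) * H := by
    rw [derivative_mul (f := X), derivative_X]
    ring
  rw [e]
  ext k
  simp only [coeff_add, coeff_sub, coeff_C_mul, hX, coeff_derivative, coeff_zero]
  rw [hH, coeff_shiftedJacobi, coeff_shiftedJacobi]
  linear_combination jacobiCoeff_succ n hα β k

theorem isJacobiSolution_shiftedJacobi (n : ℕ) {α : ℝ} (hα : -1 < α) (β : ℝ) :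
    IsJacobiSolution α β n ((shiftedJacobi n α β).map (algebraMap ℝ ℂ)) where
  natDegree_le := natDegree_map_le.trans (natDegree_shiftedJacobi_le n α β)
  real := by
    ext k
    simp
  ode := by
    have h := congrArg (Polynomial.map (algebraMap ℝ ℂ)) (shiftedJacobi_ode n hα β)
    simpa [derivative_map] using h

/-! ### Neumann series and the polynomials `φ_n` -/

/-- The truncated Neumann series of `(1 + ζ d/dt)⁻¹` applied to `p`. -/
noncomputable def derivSum (M : ℕ) (ζ : ℂ) (p : ℂ[X]) : ℂ[X] :=
  ∑ j ∈ Finset.range M, C ((-ζ) ^ j) * derivative^[j] p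

theorem derivSum_add (M : ℕ) (ζ : ℂ) (p q : ℂ[X]) :
    derivSum M ζ (p + q) = derivSum M ζ p + derivSum M ζ q := by
  simp only [derivSum, iterate_map_add, mul_add, Finset.sum_add_distrib]

theorem derivSum_C_mul (M : ℕ) (ζ c : ℂ) (p : ℂ[X]) :
    derivSum M ζ (C c * p) = C c * derivSum M ζ p := by
  simp only [derivSum, iterate_derivative_C_mul, Finset.mul_sum]
  exact Finset.sum_congr rfl fun j _ => by ring

theorem derivSum_add_C_mul_derivative {M : ℕ} (ζ : ℂ) {p : ℂ[X]} (hp : p.natDegree < M) :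
    derivSum M ζ p + C ζ * derivative (derivSum M ζ p) = p := by
  have h : ∀ N, derivSum N ζ p + C ζ * derivative (derivSum N ζ p) =
      p - C ((-ζ) ^ N) * derivative^[N] p := by
    intro N
    induction N with
    | zero => simp [derivSum]
    | succ N ih =>
      have e : derivSum (N + 1) ζ p = derivSum N ζ p + C ((-ζ) ^ N) * derivative^[N] p :=
        Finset.sum_range_succ _ _
      rw [e, derivative_add, derivative_C_mul, Function.iterate_succ_apply', pow_succ, C_mul, C_neg]
      linear_combination ih
  rw [h M, iterate_derivative_eq_zero hp, mul_zero, sub_zero]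

theorem natDegree_derivSum_le (M : ℕ) (ζ : ℂ) (p : ℂ[X]) :
    (derivSum M ζ p).natDegree ≤ p.natDegree :=
  natDegree_sum_le_of_forall_le _ _ fun j _ => (natDegree_C_mul_le _ _).trans
    ((natDegree_iterate_derivative p j).trans (Nat.sub_le _ _))

theorem eval_one_iterate_derivative_jacobiPoly (n : ℕ) (α β : ℝ) (k : ℕ) :
    (derivative^[k] (jacobiPoly n α β)).eval 1 =
      (-1 / 2) ^ k * (derivative^[k] (shiftedJacobi n α β)).eval 0 := by
  have h : derivative^[k] (jacobiPoly n α β) = C ((-1 / 2) ^ k) *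
      (derivative^[k] (shiftedJacobi n α β)).comp (C (1 / 2 : ℝ) * (1 - X)) := by
    induction k with
    | zero => simp [jacobiPoly_eq_comp]
    | succ k ih =>
      rw [Function.iterate_succ_apply', Function.iterate_succ_apply', ih, derivative_C_mul,
        derivative_comp, derivative_C_mul, derivative_sub, derivative_one, derivative_X, pow_succ,
        C_mul, show (-1 / 2 : ℝ) = -(1 / 2) by norm_num, C_neg]
      ring
  rw [h]
  simp [eval_comp]

theorem aeval_phiPoly {n N : ℕ} (hN : n < N) (α β : ℝ) (w : ℂ) :
    aeval w (phiPoly n α β) = ∑ k ∈ Finset.range N,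
      (((derivative^[2 * k] (jacobiPoly n α β)).eval 1 : ℝ) : ℂ) * w ^ k := by
  simp only [phiPoly, map_sum, map_mul, map_pow, aeval_C, aeval_X, Complex.coe_algebraMap]
  refine Finset.sum_subset (Finset.range_subset_range.2 (by omega)) ?_
  intro k _ hk
  rw [Finset.mem_range, not_lt] at hk
  rw [eval_one_iterate_derivative_jacobiPoly, iterate_derivative_eq_zero]
  · simp
  · exact lt_of_le_of_lt (natDegree_shiftedJacobi_le n α β) (by omega)

/-- Since `d/dt = -2 d/dx`, the `j`-th term is `(2ζ)^j` times the `j`-th `x`-derivative at `1`. Even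
`j` give `φ_{n+1}`; odd `j` lose one derivative by passing to degree `n` and parameters `α+1, β+1`.
All terms past the degree vanish. -/
theorem derivSum_eval_zero_eq_phiPoly {n N : ℕ} (hN : n + 1 < N) {α : ℝ} (hα : -1 < α) (β : ℝ)
    (ζ : ℂ) :
    (derivSum (2 * N) ζ ((shiftedJacobi (n + 1) α β).map (algebraMap ℝ ℂ))).eval 0 =
      aeval ((2 * ζ) ^ 2) (phiPoly (n + 1) α β) +
        ((n : ℝ) + 1 + α + β + 1 : ℝ) * ζ * aeval ((2 * ζ) ^ 2) (phiPoly n (α + 1) (β + 1)) := by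
  have hev : ∀ k, (derivative^[k] ((shiftedJacobi (n + 1) α β).map (algebraMap ℝ ℂ))).eval 0 =
      (((derivative^[k] (shiftedJacobi (n + 1) α β)).eval 0 : ℝ) : ℂ) := by
    intro k
    rw [iterate_derivative_map, ← coeff_zero_eq_eval_zero, ← coeff_zero_eq_eval_zero, coeff_map]
    rfl
  have hodd : ∀ k, derivative^[2 * k + 1] (shiftedJacobi (n + 1) α β) =
      C (-((n : ℝ) + 1 + α + β + 1)) * derivative^[2 * k] (shiftedJacobi n (α + 1) (β + 1)) := by
    intro k
    rw [Function.iterate_succ_apply, derivative_shiftedJacobi n hα β, iterate_derivative_C_mul]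
  have hsplit : ∀ (f : ℕ → ℂ) (N : ℕ), ∑ j ∈ Finset.range (2 * N), f j =
      ∑ k ∈ Finset.range N, f (2 * k) + ∑ k ∈ Finset.range N, f (2 * k + 1) := by
    intro f N
    induction N with
    | zero => simp
    | succ N ih =>
      rw [mul_add, mul_one, Finset.sum_range_succ, Finset.sum_range_succ, ih,
        Finset.sum_range_succ, Finset.sum_range_succ]
      ring
  rw [aeval_phiPoly hN, aeval_phiPoly (show n < N by omega), derivSum, eval_finsetSum, hsplit,
    Finset.mul_sum]
  congr 1
  · refine Finset.sum_congr rfl fun k _ => ?_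
    rw [eval_mul, eval_C, hev, eval_one_iterate_derivative_jacobiPoly, ← pow_mul]
    push_cast
    rw [mul_pow 2 ζ, neg_pow, div_pow, pow_mul (-1 : ℂ)]
    field_simp
  · refine Finset.sum_congr rfl fun k _ => ?_
    rw [eval_mul, eval_C, hev, eval_one_iterate_derivative_jacobiPoly, ← pow_mul, hodd, eval_mul,
      eval_C]
    push_cast
    rw [mul_pow 2 ζ, pow_succ, neg_pow, div_pow, pow_mul (-1 : ℂ)]
    field_simp

theorem phiPoly_eval_zero_pos (n : ℕ) {α : ℝ} (hα : -1 < α) (β : ℝ) :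
    0 < (phiPoly n α β).eval 0 := by
  rw [phiPoly, eval_finsetSum, Finset.sum_eq_single 0]
  · have h := eval_one_iterate_derivative_jacobiPoly n α β 0
    simp only [Function.iterate_zero, id, pow_zero, one_mul] at h
    have h2 := jacobiCoeff_zero_pos n hα β
    rw [← coeff_shiftedJacobi, coeff_zero_eq_eval_zero] at h2
    simpa [h] using h2
  · intro k _ hk
    simp [hk]
  · simp

theorem eval_zero_shiftedJacobi_map_ne_zero (n : ℕ) {α : ℝ} (hα : -1 < α) (β : ℝ) :
    ((shiftedJacobi n α β).map (algebraMap ℝ ℂ)).eval 0 ≠ 0 := by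
  rw [← coeff_zero_eq_eval_zero, coeff_map, coeff_shiftedJacobi]
  simpa using (jacobiCoeff_zero_pos n hα β).ne'

theorem jacobiCoeff_self_mul_neg (n : ℕ) {α β : ℝ} (hα : -1 < α) (hαβ : -1 < α + β) :
    jacobiCoeff (n + 1) α β (n + 1) * jacobiCoeff n α β n < 0 := by
  obtain ⟨r, hr, hr'⟩ := exists_jacobiCoeff_self_eq n hα hαβ
  obtain ⟨s, hs, hs'⟩ := exists_jacobiCoeff_self_eq (n + 1) hα hαβ
  have h1 : ((-1 : ℝ) ^ n) * (-1) ^ n = 1 := by rw [← mul_pow]; simp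
  have : jacobiCoeff (n + 1) α β (n + 1) * jacobiCoeff n α β n = -(r * s) := by
    rw [hr', hs', pow_succ]
    linear_combination (-(r * s)) * h1
  rw [this]
  exact neg_neg_of_pos (mul_pos hr hs)

section

variable {α β A : ℝ} {m M : ℕ} {ζ : ℂ}

theorem derivSum_shift_lower_ne_zero (hA : 0 < A) (hα : -1 < α) (hα' : α < 1) (hβ : 0 < β)
    (hM : m + 1 < M) (hζ : 0 ≤ ζ.re) :
    (derivSum M ζ (C (A : ℂ) * (shiftedJacobi (m + 1) α β).map (algebraMap ℝ ℂ) +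
      C (2 * ζ) * (shiftedJacobi m α β).map (algebraMap ℝ ℂ))).eval 0 ≠ 0 := by
  have hH := isJacobiSolution_shiftedJacobi (m + 1) hα β
  have hG := isJacobiSolution_shiftedJacobi m hα β
  have hd : (C (A : ℂ) * (shiftedJacobi (m + 1) α β).map (algebraMap ℝ ℂ) +
      C (2 * ζ) * (shiftedJacobi m α β).map (algebraMap ℝ ℂ)).natDegree ≤ m + 1 :=
    natDegree_add_le_of_degree_le ((natDegree_C_mul_le _ _).trans hH.natDegree_le)
      ((natDegree_C_mul_le _ _).trans (hG.natDegree_le.trans m.le_succ))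
  have hU := derivSum_add_C_mul_derivative ζ (lt_of_le_of_lt hd hM)
  by_cases h0 : ζ = 0
  · subst h0
    rw [C_0, zero_mul, add_zero] at hU
    rw [hU, mul_zero, C_0, zero_mul, add_zero, eval_mul, eval_C]
    exact mul_ne_zero (by exact_mod_cast hA.ne') (eval_zero_shiftedJacobi_map_ne_zero _ hα β)
  · exact hH.eval_zero_ne_zero_of_shift_lower hG
      (isJacobiFunctional_jacobiIntegral hα (by linarith)) hα hα' hβ
      (h := jacobiCoeff (m + 1) α β (m + 1)) (g := jacobiCoeff m α β m)
      (by rw [coeff_map, coeff_shiftedJacobi]; rfl) (by rw [coeff_map, coeff_shiftedJacobi]; rfl)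
      (jacobiCoeff_self_mul_neg m hα (by linarith)) hA h0 hζ
      ((natDegree_derivSum_le _ _ _).trans hd) hU

theorem derivSum_shift_upper_ne_zero (hA : 0 < A) (hα : -1 < α) (hα' : α < 0) (hβ : 0 < β)
    (hM : m + 1 < M) (hζ : 0 ≤ ζ.re) :
    (derivSum M ζ (C (2 * ζ) * (shiftedJacobi (m + 1) α β).map (algebraMap ℝ ℂ) +
      C (A : ℂ) * (shiftedJacobi m α β).map (algebraMap ℝ ℂ))).eval 0 ≠ 0 := by
  have hH := isJacobiSolution_shiftedJacobi (m + 1) hα β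
  have hG := isJacobiSolution_shiftedJacobi m hα β
  have hd : (C (2 * ζ) * (shiftedJacobi (m + 1) α β).map (algebraMap ℝ ℂ) +
      C (A : ℂ) * (shiftedJacobi m α β).map (algebraMap ℝ ℂ)).natDegree ≤ m + 1 :=
    natDegree_add_le_of_degree_le ((natDegree_C_mul_le _ _).trans hH.natDegree_le)
      ((natDegree_C_mul_le _ _).trans (hG.natDegree_le.trans m.le_succ))
  have hU := derivSum_add_C_mul_derivative ζ (lt_of_le_of_lt hd hM)
  by_cases h0 : ζ = 0
  · subst h0
    rw [C_0, zero_mul, add_zero] at hU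
    rw [hU, mul_zero, C_0, zero_mul, zero_add, eval_mul, eval_C]
    exact mul_ne_zero (by exact_mod_cast hA.ne') (eval_zero_shiftedJacobi_map_ne_zero _ hα β)
  · exact hH.eval_zero_ne_zero_of_shift_upper hG
      (isJacobiFunctional_jacobiIntegral hα (by linarith)) hα hα' hβ
      (h := jacobiCoeff (m + 1) α β (m + 1)) (g := jacobiCoeff m α β m)
      (by rw [coeff_map, coeff_shiftedJacobi]; rfl) (by rw [coeff_map, coeff_shiftedJacobi]; rfl)
      (jacobiCoeff_self_mul_neg m hα (by linarith)) hA h0 hζ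
      ((natDegree_derivSum_le _ _ _).trans hd) hU

end

/-! ### The interlacing theorem -/

theorem corollary7 (n : ℕ) (hn : 3 < n) (α β A : ℝ) (hA : 0 < A)
    (hα : -1 < α) (hα' : α < 1) (hβ : 0 < β) :
    ZerosInterlace
      (Polynomial.C (2 * A) * phiPoly n α β +
        Polynomial.C ((n : ℝ) + α + β) * Polynomial.X * phiPoly (n - 2) (α + 1) (β + 1))
      (Polynomial.C (A * ((n : ℝ) + α + β + 1)) * phiPoly (n - 1) (α + 1) (β + 1) +
        Polynomial.C 2 * phiPoly (n - 1) α β) ∧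
    (α < 0 →
      ZerosInterlace
        (Polynomial.C ((n : ℝ) + α + β + 1) * Polynomial.X * phiPoly (n - 1) (α + 1) (β + 1) +
          Polynomial.C (2 * A) * phiPoly (n - 1) α β)
        (Polynomial.C 2 * phiPoly n α β +
          Polynomial.C (A * ((n : ℝ) + α + β)) * phiPoly (n - 2) (α + 1) (β + 1))) := by
  obtain ⟨m, rfl⟩ : ∃ m, n = m + 2 := ⟨n - 2, by omega⟩
  rw [show m + 2 - 2 = m by omega, show m + 2 - 1 = m + 1 by omega]
  have hm : (0 : ℝ) ≤ m := Nat.cast_nonneg m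
  have hH := fun ζ => derivSum_eval_zero_eq_phiPoly (n := m + 1) (N := m + 3) (by omega) hα β ζ
  have hG := fun ζ => derivSum_eval_zero_eq_phiPoly (n := m) (N := m + 3) (by omega) hα β ζ
  have hP : ∀ k, 0 < (phiPoly k α β).eval 0 := fun k => phiPoly_eval_zero_pos k hα β
  have hP' : ∀ k, 0 < (phiPoly k (α + 1) (β + 1)).eval 0 :=
    fun k => phiPoly_eval_zero_pos k (by linarith) _
  have hc1 : 0 < A * (((m + 2 : ℕ) : ℝ) + α + β + 1) := by
    push_cast; exact mul_pos hA (by linarith)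
  have hc2 : 0 < A * (((m + 2 : ℕ) : ℝ) + α + β) := by
    push_cast; exact mul_pos hA (by linarith)
  refine ⟨zerosInterlace_of_hurwitz ?_ ?_, fun hα'' => zerosInterlace_of_hurwitz ?_ ?_⟩
  · intro h
    -- At `μ = 0` both summands are positive, so the second polynomial is nonzero.
    have h1 := congrArg (eval 0) h
    simp only [eval_add, eval_mul, eval_C, eval_zero] at h1
    have := mul_pos hc1 (hP' (m + 1))
    have := hP (m + 1)
    linarith
  · intro z hz h
    -- With `ζ = z/2` the arguments `(2ζ)²` become `z²`, and the value at `0` is half of `g(z²) + z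
    -- h(z²)`.
    refine derivSum_shift_lower_ne_zero (M := 2 * (m + 3)) (m := m + 1) (ζ := z / 2) hA hα hα' hβ
      (by omega) (by rw [Complex.div_ofNat_re]; positivity) ?_
    rw [derivSum_add, derivSum_C_mul, derivSum_C_mul, eval_add, eval_mul, eval_mul, hH, hG,
      eval_C, eval_C, mul_div_cancel₀ z two_ne_zero]
    simp only [map_add, map_mul, aeval_C, aeval_X, Complex.coe_algebraMap] at h
    push_cast at h ⊢
    linear_combination (1 / 2 : ℂ) * h
  · intro h
    have h1 := congrArg (eval 0) h
    simp only [eval_add, eval_mul, eval_C, eval_zero] at h1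
    have := mul_pos hc2 (hP' m)
    have := hP (m + 2)
    linarith
  · intro z hz h
    refine derivSum_shift_upper_ne_zero (M := 2 * (m + 3)) (m := m + 1) (ζ := z / 2) hA hα hα'' hβ
      (by omega) (by rw [Complex.div_ofNat_re]; positivity) ?_
    rw [derivSum_add, derivSum_C_mul, derivSum_C_mul, eval_add, eval_mul, eval_mul, hH, hG,
      eval_C, eval_C, mul_div_cancel₀ z two_ne_zero]
    simp only [map_add, map_mul, aeval_C, aeval_X, Complex.coe_algebraMap] at h
    push_cast at h ⊢
    linear_combination (1 / 2 : ℂ) * h
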